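/- **Setting.** Fix $0<A<B<1$ and a probability space $(\Omega,\mathcal P)$. Let $(a_n,b_n)_{n\ge1}$ be i.i.d. random pairs with $A\le\min(a_n,b_n)$ and $a_n+b_n\le B$, and let $(p_n)_{n\ge1}$ be i.i.d. random variables with values in $[0,1]$, the sequence $(p_n)$ being independent of the sequence $((a_n,b_n))$, such that $\mathbb E(p_1^{-t})<\infty$ and $\mathbb E((1-p_1)^{-t})<\infty$ for some $t>0$. For each $\omega$, the only Moran interval of step $0$ is $[0,1]$; a Moran interval $I$ of step $n-1$ has two children of step $n$: the closed subinterval of length $a_n(\omega)|I|$ with the same left end point (left child) and the closed subinterval of length $b_n(\omega)|I|$ with the same right end point (right child). Let $\mu_\omega$ be the Borel probability measure on $[0,1]$ such that every Moran interval $I$ of step $n-1$ satisfies $\mu_\omega(\text{left child of }I)=p_n(\omega)\mu_\omega(I)$ and $\mu_\omega(\text{right child of }I)=(1-p_n(\omega))\mu_\omega(I)$. **Dimensions.** A dimension function is a map $\Phi:(0,1)\to\mathbb R$ for which, near $0$, $\Phi\ge 0$ and $t^{1+\Phi(t)}$ decreases (not necessarily strictly) to $0$ as $t$ decreases to $0$.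 It is called large if, near $0$, $\Phi(t)=H(t)\,\frac{\log|\log t|}{|\log t|}$ with $H(t)\to\infty$ as $t\to0^+$. The upper $\Phi$-dimension $\overline{\dim}_\Phi\mu\in[-\infty,\infty]$ of a measure $\mu$ is the infimum of all real $d$ for which there are $C_1,C_2>0$ such that $$\frac{\mu(B(x,R))}{\mu(B(x,r))}\le C_2\Big(\frac Rr\Big)^d\quad\text{for all }x\in\operatorname{supp}\mu\text{ and all }0<r<R^{1+\Phi(R)}\le R\le C_1,\ R<1,$$ where $B(x,r)$ is the open ball. **The function $G$.** For $\theta\ge0$ put $Y(\theta)=\log p_1$ and $Z(\theta)=\log a_1$ on the event $p_1\le \frac{a_1^\theta}{a_1^\theta+b_1^\theta}$, put $Y(\theta)=\log(1-p_1)$ and $Z(\theta)=\log b_1$ on the complementary event, and let $G(\theta)=\mathbb E(Y(\theta))/\mathbb E(Z(\theta))$. **Theorem.** Suppose that $\mathbb E(\log p_1)$ and $\mathbb E(\log(1-p_1))$ are finite and that $G$ is continuous on $[0,\infty)$. Then there is a unique $\alpha\ge0$ such that $G(\alpha)=\alpha$ and $G(\psi)<\psi$ for all $\psi>\alpha$.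 For this $\alpha$ there is a set $\Gamma\subseteq\Omega$ of full measure such that $\overline{\dim}_\Phi\mu_\omega=\alpha$ for all $\omega\in\Gamma$ and all large dimension functions $\Phi$. -/

import Mathlib

open MeasureTheory ProbabilityTheory Filter Topology Set
open scoped ENNReal

noncomputable section

/-! ### Dimension functions and the upper `Φ`-dimension -/

/-- Dimension functions: near `0` the function `Φ` is non-negative, and `t ^ (1 + Φ t)` decreases
to `0` as `t` decreases to `0`. Only the values of `Φ` on `(0, 1)` near `0` are relevant. -/
structure IsDimensionFunction (Φ : ℝ → ℝ) : Prop where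
  exists_nonneg_monotone : ∃ δ ∈ Ioc (0 : ℝ) 1, (∀ t ∈ Ioo 0 δ, 0 ≤ Φ t) ∧
    MonotoneOn (fun t => t ^ (1 + Φ t)) (Ioo 0 δ)
  tendsto_zero : Tendsto (fun t => t ^ (1 + Φ t)) (𝓝[>] 0) (𝓝 0)

/-- Large dimension functions: `Φ(t) = H(t) log |log t| / |log t|` with `H(t) → ∞`, as `t → 0`. -/
structure IsLargeDimensionFunction (Φ : ℝ → ℝ) : Prop extends IsDimensionFunction Φ where
  exists_factor : ∃ H : ℝ → ℝ, Tendsto H (𝓝[>] 0) atTop ∧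
    ∀ᶠ t in 𝓝[>] 0, Φ t = H t * (Real.log |Real.log t| / |Real.log t|)

/-- The upper `Φ`-dimension of a measure, as an infimum of real exponents `d` taken in the
extended reals (so that it is `⊤` if there is no admissible exponent). -/
def upperPhiDim {X : Type*} [PseudoMetricSpace X] [MeasurableSpace X]
    (Φ : ℝ → ℝ) (μ : Measure X) : EReal :=
  sInf {D : EReal | ∃ d : ℝ, D = d ∧ ∃ C₁ > 0, ∃ C₂ > 0, ∀ r R : ℝ,
    0 < r → r < R ^ (1 + Φ R) → R ^ (1 + Φ R) ≤ R → R ≤ C₁ → R < 1 → ∀ x ∈ μ.support,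
      μ (Metric.ball x R) / μ (Metric.ball x r) ≤ ENNReal.ofReal (C₂ * (R / r) ^ d)}

/-! ### Moran intervals and the Moran measure

Here `a`, `b`, `p` are the sequences of left ratios, right ratios and left probabilities; the entry
with index `n` is the one used in passing from step `n` to step `n + 1`. An infinite word
`σ : ℕ → Bool` picks the left (`false`) or the right (`true`) child at each step. -/

/-- Length of the step `n` Moran interval with address `σ 0, …, σ (n - 1)`. -/
def moranLength (a b : ℕ → ℝ) (σ : ℕ → Bool) : ℕ → ℝ
  | 0 => 1
  | n + 1 => (if σ n then b n else a n) * moranLength a b σ n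

/-- Left end point of the step `n` Moran interval with address `σ 0, …, σ (n - 1)`: a left child
keeps the left end point of its parent, a right child keeps the right end point. -/
def moranLeft (a b : ℕ → ℝ) (σ : ℕ → Bool) : ℕ → ℝ
  | 0 => 0
  | n + 1 => moranLeft a b σ n + if σ n then (1 - b n) * moranLength a b σ n else 0

/-- The step `n` Moran interval with address `σ 0, …, σ (n - 1)`. -/
def moranInterval (a b : ℕ → ℝ) (σ : ℕ → Bool) (n : ℕ) : Set ℝ :=
  Icc (moranLeft a b σ n) (moranLeft a b σ n + moranLength a b σ n)

/-- The point of the Moran set with address `σ`: the limit of the left end points of the nested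
Moran intervals along `σ`. -/
def moranPoint (a b : ℕ → ℝ) (σ : ℕ → Bool) : ℝ := ⨆ n, moranLeft a b σ n

/-- The Moran measure: the image, under the address map, of the product measure on words that
gives the letter `false` (left) in position `n` the probability `p n`. -/
def moranMeasure (a b : ℕ → ℝ) (p : ℕ → unitInterval) : Measure ℝ :=
  (Measure.infinitePi fun n => bernoulliMeasure false true (p n)).map (moranPoint a b)

/-! The measure just built is the one given by the subdivision rule. -/

section Rule

variable {a b : ℕ → ℝ}

theorem measurable_moranPoint : Measurable (moranPoint a b) := by
  have hs : ∀ n, MeasurableSet {σ : ℕ → Bool | σ n = true} := fun n =>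
    measurableSet_eq_fun (measurable_pi_apply n) measurable_const
  have hb : ∀ n, Measurable fun σ : ℕ → Bool => moranLength a b σ n := by
    intro n
    induction n with
    | zero => exact measurable_const
    | succ n ih =>
      exact (Measurable.ite (hs n) measurable_const measurable_const).mul ih
  refine Measurable.iSup fun n => ?_
  induction n with
  | zero => exact measurable_const
  | succ n ih =>
    exact ih.add (Measurable.ite (hs n) (measurable_const.mul (hb n)) measurable_const)

instance isProbabilityMeasure_moranMeasure (p : ℕ → unitInterval) :
    IsProbabilityMeasure (moranMeasure a b p) :=
  Measure.isProbabilityMeasure_map measurable_moranPoint.aemeasurable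

theorem moranLength_pos (ha : ∀ n, 0 < a n) (hb : ∀ n, 0 < b n) (σ : ℕ → Bool) (n : ℕ) :
    0 < moranLength a b σ n := by
  induction n with
  | zero => exact one_pos
  | succ n ih =>
    simp only [moranLength]
    split_ifs
    · exact mul_pos (hb n) ih
    · exact mul_pos (ha n) ih

theorem moranInterval_succ_subset (ha : ∀ n, 0 < a n) (hb : ∀ n, 0 < b n)
    (hab : ∀ n, a n + b n < 1) (σ : ℕ → Bool) (n : ℕ) :
    moranLeft a b σ n ≤ moranLeft a b σ (n + 1) ∧
      moranLeft a b σ (n + 1) + moranLength a b σ (n + 1) ≤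
        moranLeft a b σ n + moranLength a b σ n := by
  have h := moranLength_pos ha hb σ n
  have h1 := ha n
  have h2 := hb n
  have h3 := hab n
  simp only [moranLeft, moranLength]
  split_ifs
  · constructor <;> nlinarith
  · constructor <;> nlinarith

theorem moranPoint_mem (ha : ∀ n, 0 < a n) (hb : ∀ n, 0 < b n)
    (hab : ∀ n, a n + b n < 1) (σ : ℕ → Bool) (n : ℕ) :
    moranPoint a b σ ∈ moranInterval a b σ n := by
  have hmono : Monotone (moranLeft a b σ) :=
    monotone_nat_of_le_succ fun n => (moranInterval_succ_subset ha hb hab σ n).1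
  have hanti : Antitone fun n => moranLeft a b σ n + moranLength a b σ n :=
    antitone_nat_of_succ_le fun n => (moranInterval_succ_subset ha hb hab σ n).2
  have hle : ∀ m n, moranLeft a b σ m ≤ moranLeft a b σ n + moranLength a b σ n := by
    intro m n
    have h1 := hmono (le_max_left m n)
    have h2 := hanti (le_max_right m n)
    have h3 := moranLength_pos ha hb σ (max m n)
    simp only at h2
    linarith
  exact ⟨le_ciSup (f := moranLeft a b σ) ⟨_, forall_mem_range.2 fun m => hle m 0⟩ n,
    ciSup_le fun m => hle m n⟩

theorem moranInterval_congr {σ τ : ℕ → Bool} {n : ℕ} (h : ∀ i < n, τ i = σ i) :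
    moranLeft a b τ n = moranLeft a b σ n ∧ moranLength a b τ n = moranLength a b σ n := by
  induction n with
  | zero => exact ⟨rfl, rfl⟩
  | succ n ih =>
    obtain ⟨h1, h2⟩ := ih fun i hi => h i (by omega)
    simp only [moranLeft, moranLength, h1, h2, h n (by omega), and_self]

theorem moranPoint_mem_iff (ha : ∀ n, 0 < a n) (hb : ∀ n, 0 < b n)
    (hab : ∀ n, a n + b n < 1) (σ τ : ℕ → Bool) (n : ℕ) :
    moranPoint a b τ ∈ moranInterval a b σ n ↔ ∀ i < n, τ i = σ i := by
  constructor
  · induction n with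
    | zero => intro _ i hi; omega
    | succ n ih =>
      intro hx
      have hs := moranInterval_succ_subset ha hb hab σ n
      have hn := ih ⟨hs.1.trans hx.1, hx.2.trans hs.2⟩
      obtain ⟨e1, e2⟩ := moranInterval_congr (a := a) (b := b) hn
      have hy := moranPoint_mem ha hb hab τ (n + 1)
      have hpos := moranLength_pos ha hb σ n
      have h3 := hab n
      have key : τ n = σ n := by
        simp only [moranInterval, moranLeft, moranLength, mem_Icc, e1, e2] at hx hy
        rcases hσ : σ n with _ | _ <;> rcases hτ : τ n with _ | _ <;>
          simp only [hσ, hτ, if_true, if_false, Bool.false_eq_true] at hx hy ⊢ <;> nlinarith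
      intro i hi
      rcases Nat.lt_succ_iff_lt_or_eq.1 hi with h | rfl
      · exact hn i h
      · exact key
  · intro h
    have := moranPoint_mem ha hb hab τ n
    obtain ⟨e1, e2⟩ := moranInterval_congr (a := a) (b := b) h
    simpa only [moranInterval, e1, e2] using this

theorem moranMeasure_moranInterval (ha : ∀ n, 0 < a n) (hb : ∀ n, 0 < b n)
    (hab : ∀ n, a n + b n < 1) (p : ℕ → unitInterval) (σ : ℕ → Bool) (n : ℕ) :
    moranMeasure a b p (moranInterval a b σ n) =
      ∏ i ∈ Finset.range n, ENNReal.ofReal (if σ i then 1 - (p i : ℝ) else p i) := by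
  have hpre : moranPoint a b ⁻¹' moranInterval a b σ n =
      Set.pi (Finset.range n : Set ℕ) fun i => {σ i} := by
    ext τ
    simp [Set.mem_pi, moranPoint_mem_iff ha hb hab]
  rw [moranMeasure, Measure.map_apply measurable_moranPoint (by exact measurableSet_Icc), hpre,
    Measure.infinitePi_pi _ fun i _ => measurableSet_singleton _]
  refine Finset.prod_congr rfl fun i _ => ?_
  rw [← ofReal_measureReal]
  congr 1
  rcases σ i with _ | _
  · simp
  · simp

/-- The unit interval has mass one. -/
theorem moranMeasure_Icc (ha : ∀ n, 0 < a n) (hb : ∀ n, 0 < b n)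
    (hab : ∀ n, a n + b n < 1) (p : ℕ → unitInterval) : moranMeasure a b p (Icc 0 1) = 1 := by
  simpa [moranInterval, moranLeft, moranLength] using
    moranMeasure_moranInterval ha hb hab p (fun _ => false) 0

/-- A left child gets the proportion `p n` of the mass of its step `n` parent, a right child gets
the proportion `1 - p n`. -/
theorem moranMeasure_child (ha : ∀ n, 0 < a n) (hb : ∀ n, 0 < b n)
    (hab : ∀ n, a n + b n < 1) (p : ℕ → unitInterval) (σ : ℕ → Bool) (n : ℕ) :
    moranMeasure a b p (moranInterval a b σ (n + 1)) =
      ENNReal.ofReal (if σ n then 1 - (p n : ℝ) else p n) *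
        moranMeasure a b p (moranInterval a b σ n) := by
  simp only [moranMeasure_moranInterval ha hb hab]
  rw [Finset.prod_range_succ, mul_comm]

end Rule

/-! ### The random model and the function `G` -/

/-- The standing assumptions on the random ratios `(a n, b n)` and the random probabilities `p n`.
(Expectations of negative powers are Lebesgue integrals in `[0, ∞]`, with `0 ^ (-t) = ∞`.) -/
structure IsMoranModel {Ω : Type*} [MeasurableSpace Ω] (P : Measure Ω) (A B : ℝ)
    (a b : ℕ → Ω → ℝ) (p : ℕ → Ω → unitInterval) : Prop where
  A_pos : 0 < A
  A_lt_B : A < B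
  B_lt_one : B < 1
  measurable_a : ∀ n, Measurable (a n)
  measurable_b : ∀ n, Measurable (b n)
  measurable_p : ∀ n, Measurable (p n)
  le_min : ∀ n ω, A ≤ min (a n ω) (b n ω)
  add_le : ∀ n ω, a n ω + b n ω ≤ B
  indep_ab : iIndepFun (fun n ω => (a n ω, b n ω)) P
  identDistrib_ab : ∀ n, IdentDistrib (fun ω => (a n ω, b n ω)) (fun ω => (a 0 ω, b 0 ω)) P P
  indep_p : iIndepFun p P
  identDistrib_p : ∀ n, IdentDistrib (p n) (p 0) P P
  indep_ab_p : IndepFun (fun ω n => (a n ω, b n ω)) (fun ω n => p n ω) P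
  moment_p : ∃ t : ℝ, 0 < t ∧ ∫⁻ ω, ENNReal.ofReal (p 0 ω : ℝ) ^ (-t) ∂P < ∞
  moment_one_sub_p : ∃ t : ℝ, 0 < t ∧ ∫⁻ ω, ENNReal.ofReal (1 - (p 0 ω : ℝ)) ^ (-t) ∂P < ∞

/-- `Y(θ)` as a function of the values `x`, `y`, `q` of `a`, `b`, `p`. -/
def moranY (θ x y q : ℝ) : ℝ :=
  if q ≤ x ^ θ / (x ^ θ + y ^ θ) then Real.log q else Real.log (1 - q)

/-- `Z(θ)` as a function of the values `x`, `y`, `q` of `a`, `b`, `p`. -/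
def moranZ (θ x y q : ℝ) : ℝ :=
  if q ≤ x ^ θ / (x ^ θ + y ^ θ) then Real.log x else Real.log y

/-- `G(θ) = 𝔼 Y₁(θ) / 𝔼 Z₁(θ)`. -/
def moranG {Ω : Type*} [MeasurableSpace Ω] (P : Measure Ω)
    (a b : ℕ → Ω → ℝ) (p : ℕ → Ω → unitInterval) (θ : ℝ) : ℝ :=
  (∫ ω, moranY θ (a 0 ω) (b 0 ω) (p 0 ω) ∂P) / ∫ ω, moranZ θ (a 0 ω) (b 0 ω) (p 0 ω) ∂P

end

/-! For a word `σ` write `I_n` for the step `n` Moran interval along `σ`, and `μ` for the Moran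
measure. Subdividing `I_n` adds to `log (μ I_n / |I_n| ^ θ)` one of two increments; let `X n` be the
smaller one. It has exponential moments, and its mean is strictly increasing and continuous in `θ`.
As `𝔼 X = 𝔼 Y(θ) - θ 𝔼 Z(θ)` with `𝔼 Z(θ) < 0`, that mean has the sign of `θ - G(θ)`. Its zero is
`α`.

If `θ < α`, then by the law of large numbers the word choosing the smaller increment at each step
satisfies `μ I_n ≤ |I_n| ^ θ` for all large `n`, so that a single point already forces the dimension
to be at least `θ`. If `θ > α`, then by Chernoff's bound and the Borel–Cantelli lemma the sum of `X`
over every block of length at least `K log n` starting at a large `n` is non-negative, so that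
`μ I_n / μ I_m ≤ (|I_n| / |I_m|) ^ θ` along every word if `m - n ≥ K log n`. As the lengths of
step `n` intervals are exponentially small in `n`, the scales `r < R ^ (1 + Φ R)` are that far apart
for every large `Φ`. Intervals and balls are interchangeable because siblings are separated by a
proportion at least `1 - B` of their parent. -/

/-! ### The upper `Φ`-dimension -/

theorem IsDimensionFunction.eventually_nonneg {Φ : ℝ → ℝ} (hΦ : IsDimensionFunction Φ) :
    ∀ᶠ t in 𝓝[>] 0, 0 ≤ Φ t := by
  obtain ⟨δ, hδ, hnonneg, -⟩ := hΦ.exists_nonneg_monotone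
  filter_upwards [Ioo_mem_nhdsGT hδ.1] using hnonneg

theorem le_upperPhiDim_of_frequently_measure_ball_le {X : Type*} [PseudoMetricSpace X]
    [MeasurableSpace X] {μ : Measure X} {Φ : ℝ → ℝ} (hΦ : ∀ᶠ t in 𝓝[>] 0, 0 ≤ Φ t) {x : X}
    (hx : x ∈ μ.support) {C θ : ℝ}
    (hball : ∃ᶠ r in 𝓝[>] 0, μ (Metric.ball x r) ≤ ENNReal.ofReal (C * r ^ θ)) :
    (θ : EReal) ≤ upperPhiDim Φ μ := by
  refine le_sInf ?_
  rintro _ ⟨d, rfl, C₁, hC₁, C₂, hC₂, hd⟩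
  rw [EReal.coe_le_coe_iff]
  by_contra! hlt
  have hball_pos {ε : ℝ} (hε : 0 < ε) : 0 < μ (Metric.ball x ε) :=
    (Measure.mem_support_iff_forall x).1 hx _ (Metric.ball_mem_nhds x hε)
  obtain ⟨R, hΦR, hR0, hR⟩ := (hΦ.and (Ioo_mem_nhdsGT (lt_min one_pos hC₁))).exists
  obtain ⟨hR1, hRC₁⟩ := lt_min_iff.1 hR
  have hRR : R ^ (1 + Φ R) ≤ R :=
    (Real.rpow_le_rpow_of_exponent_ge hR0 hR1.le (le_add_of_nonneg_right hΦR)).trans_eq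
      (Real.rpow_one R)
  have hlim : Tendsto (fun r => C₂ * R ^ d * C * r ^ (θ - d)) (𝓝[>] 0) (𝓝 0) := by
    have h := (Real.continuousAt_rpow_const 0 (θ - d) (Or.inr (sub_pos.2 hlt).le)).tendsto
    rw [Real.zero_rpow (sub_pos.2 hlt).ne'] at h
    simpa only [mul_zero] using (h.mono_left nhdsWithin_le_nhds).const_mul (C₂ * R ^ d * C)
  have hsmall : ∀ᶠ r in 𝓝[>] 0,
      ENNReal.ofReal (C₂ * R ^ d * C * r ^ (θ - d)) < μ (Metric.ball x R) := by
    refine (ENNReal.tendsto_ofReal hlim).eventually_lt_const ?_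
    simpa only [ENNReal.ofReal_zero] using hball_pos hR0
  have hscale : ∀ᶠ r in 𝓝[>] 0, r ∈ Ioo 0 (R ^ (1 + Φ R)) :=
    Ioo_mem_nhdsGT (Real.rpow_pos_of_pos hR0 _)
  obtain ⟨r, hr, ⟨hr0, hrR⟩, hrsmall⟩ := (hball.and_eventually (hscale.and hsmall)).exists
  refine hrsmall.not_ge ?_
  calc μ (Metric.ball x R) ≤ ENNReal.ofReal (C₂ * (R / r) ^ d) * μ (Metric.ball x r) :=
        (ENNReal.div_le_iff_le_mul (.inl (hball_pos hr0).ne')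
          (.inr (ENNReal.ofReal_pos.2 (by positivity)).ne')).1
          (hd r R hr0 hrR hRR hRC₁.le hR1 x hx)
    _ ≤ ENNReal.ofReal (C₂ * (R / r) ^ d) * ENNReal.ofReal (C * r ^ θ) := by gcongr
    _ = ENNReal.ofReal (C₂ * R ^ d * C * r ^ (θ - d)) := by
        rw [← ENNReal.ofReal_mul (by positivity), Real.div_rpow hR0.le hr0.le, Real.rpow_sub hr0]
        ring_nf

theorem tendsto_log_abs_log_nhdsGT_zero :
    Tendsto (fun t => Real.log |Real.log t|) (𝓝[>] 0) atTop :=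
  Real.tendsto_log_atTop.comp (tendsto_abs_atBot_atTop.comp Real.tendsto_log_nhdsGT_zero)

/-- With `Φ = H log |log| / |log|` one has `R ^ Φ R = |log R| ^ (-H R)`. -/
theorem IsLargeDimensionFunction.eventually_rpow_le {Φ : ℝ → ℝ}
    (hΦ : IsLargeDimensionFunction Φ) (c : ℝ) :
    ∀ᶠ R in 𝓝[>] 0, R ^ Φ R ≤ |Real.log R| ^ (-c) := by
  obtain ⟨H, hH, hΦH⟩ := hΦ.exists_factor
  filter_upwards [hΦH, hH.eventually_ge_atTop c, Ioo_mem_nhdsGT one_pos,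
    tendsto_log_abs_log_nhdsGT_zero.eventually_ge_atTop 0] with R hR hHR ⟨hR0, hR1⟩ hlog
  have hneg : Real.log R < 0 := Real.log_neg hR0 hR1
  have habs : 0 < |Real.log R| := abs_pos.2 hneg.ne
  have hlogR : Real.log R = -|Real.log R| := by rw [abs_of_neg hneg, neg_neg]
  rw [Real.rpow_def_of_pos hR0, Real.rpow_def_of_pos habs, Real.exp_le_exp, hR]
  calc Real.log R * (H R * (Real.log |Real.log R| / |Real.log R|))
      = -|Real.log R| * (H R * (Real.log |Real.log R| / |Real.log R|)) := congrArg (· * _) hlogR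
    _ = Real.log |Real.log R| * -H R := by field_simp
    _ ≤ Real.log |Real.log R| * -c := by gcongr

theorem eventually_log_le_two_mul_log_abs_log {B : ℝ} (hB : B ∈ Ioo (0 : ℝ) 1) :
    ∀ᶠ R in 𝓝[>] 0, ∀ n : ℕ, R ≤ B ^ n → Real.log n ≤ 2 * Real.log |Real.log R| := by
  have hlogB : 0 < -Real.log B := neg_pos.2 (Real.log_neg hB.1 hB.2)
  filter_upwards [Ioo_mem_nhdsGT one_pos, tendsto_log_abs_log_nhdsGT_zero.eventually_ge_atTop 0,
    tendsto_log_abs_log_nhdsGT_zero.eventually_ge_atTop (-Real.log (-Real.log B))]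
    with R ⟨hR0, hR1⟩ hlog hlog' n hn
  rcases n.eq_zero_or_pos with rfl | hn_pos
  · simpa only [Nat.cast_zero, Real.log_zero] using mul_nonneg zero_le_two hlog
  have hn_pos : (0 : ℝ) < n := Nat.cast_pos.2 hn_pos
  have hle : n * -Real.log B ≤ |Real.log R| := by
    rw [abs_of_neg (Real.log_neg hR0 hR1), mul_neg, neg_le_neg_iff, ← Real.log_pow]
    exact Real.log_le_log hR0 hn
  have hlog_le := Real.log_le_log (mul_pos hn_pos hlogB) hle
  rw [Real.log_mul hn_pos.ne' hlogB.ne'] at hlog_le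
  linarith

theorem IsLargeDimensionFunction.eventually_mul_log_le {Φ : ℝ → ℝ}
    (hΦ : IsLargeDimensionFunction Φ) {A B K : ℝ} (hA : A ∈ Ioo (0 : ℝ) 1)
    (hB : B ∈ Ioo (0 : ℝ) 1) (hK : 0 ≤ K) :
    ∀ᶠ R in 𝓝[>] 0, ∀ n k : ℕ, R ≤ B ^ n → A ^ k ≤ R ^ Φ R → K * Real.log n ≤ k := by
  have hlogA : 0 < -Real.log A := neg_pos.2 (Real.log_neg hA.1 hA.2)
  filter_upwards [hΦ.eventually_rpow_le (K * 2 * -Real.log A),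
    eventually_log_le_two_mul_log_abs_log hB, Ioo_mem_nhdsGT one_pos] with R hR hlog ⟨hR0, hR1⟩
    n k hn hk
  have habs : 0 < |Real.log R| := abs_pos.2 (Real.log_neg hR0 hR1).ne
  have hk' := Real.log_le_log (pow_pos hA.1 k) (hk.trans hR)
  rw [Real.log_pow, Real.log_rpow habs] at hk'
  refine le_of_mul_le_mul_right ?_ hlogA
  calc K * Real.log n * -Real.log A ≤ K * (2 * Real.log |Real.log R|) * -Real.log A := by
        gcongr
        exact hlog n hn
    _ ≤ k * -Real.log A := by linarith

/-! ### Masses and lengths along a word -/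

/-- Mass of the step `n` Moran interval with address `σ 0, …, σ (n - 1)`. -/
noncomputable def moranMass (p : ℕ → unitInterval) (σ : ℕ → Bool) (n : ℕ) : ℝ :=
  ∏ i ∈ Finset.range n, if σ i then 1 - (p i : ℝ) else p i

/-- The logarithm of `mass / length ^ θ` for the step `n` Moran interval with address
`σ 0, …, σ (n - 1)`. -/
noncomputable def moranLogDensity (θ : ℝ) (a b : ℕ → ℝ) (p : ℕ → unitInterval) (σ : ℕ → Bool)
    (n : ℕ) : ℝ :=
  Real.log (moranMass p σ n) - θ * Real.log (moranLength a b σ n)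

/-- The smaller of the two increments of `moranLogDensity θ` in a subdivision step with ratios `x`,
`y` and left probability `q`. -/
noncomputable def moranMinIncr (θ x y q : ℝ) : ℝ :=
  min (Real.log q - θ * Real.log x) (Real.log (1 - q) - θ * Real.log y)

section LogDensity

variable {a b : ℕ → ℝ} {p : ℕ → unitInterval}

theorem moranMass_pos (hp : ∀ n, (p n : ℝ) ∈ Ioo (0 : ℝ) 1) (σ : ℕ → Bool) (n : ℕ) :
    0 < moranMass p σ n := by
  refine Finset.prod_pos fun i _ => ?_
  split_ifs
  · exact sub_pos.2 (hp i).2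
  · exact (hp i).1

theorem moranLogDensity_succ (ha : ∀ n, 0 < a n) (hb : ∀ n, 0 < b n)
    (hp : ∀ n, (p n : ℝ) ∈ Ioo (0 : ℝ) 1) (θ : ℝ) (σ : ℕ → Bool) (n : ℕ) :
    moranLogDensity θ a b p σ (n + 1) = moranLogDensity θ a b p σ n +
      if σ n then Real.log (1 - p n) - θ * Real.log (b n)
      else Real.log (p n) - θ * Real.log (a n) := by
  have hmass := (moranMass_pos hp σ n).ne'
  have hlength := (moranLength_pos ha hb σ n).ne'
  rw [moranLogDensity, moranLogDensity, moranMass, Finset.prod_range_succ, ← moranMass, moranLength]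
  split_ifs
  · rw [Real.log_mul hmass (sub_pos.2 (hp n).2).ne', Real.log_mul (hb n).ne' hlength]
    ring
  · rw [Real.log_mul hmass (hp n).1.ne', Real.log_mul (ha n).ne' hlength]
    ring

theorem moranLogDensity_add_moranMinIncr_le (ha : ∀ n, 0 < a n) (hb : ∀ n, 0 < b n)
    (hp : ∀ n, (p n : ℝ) ∈ Ioo (0 : ℝ) 1) (θ : ℝ) (σ : ℕ → Bool) (n : ℕ) :
    moranLogDensity θ a b p σ n + moranMinIncr θ (a n) (b n) (p n) ≤
      moranLogDensity θ a b p σ (n + 1) := by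
  rw [moranLogDensity_succ ha hb hp, moranMinIncr]
  gcongr
  split_ifs
  · exact min_le_right _ _
  · exact min_le_left _ _

theorem moranLogDensity_add_sum_moranMinIncr_le (ha : ∀ n, 0 < a n) (hb : ∀ n, 0 < b n)
    (hp : ∀ n, (p n : ℝ) ∈ Ioo (0 : ℝ) 1) (θ : ℝ) (σ : ℕ → Bool) (n k : ℕ) :
    moranLogDensity θ a b p σ n + ∑ i ∈ Finset.Ico n (n + k), moranMinIncr θ (a i) (b i) (p i) ≤
      moranLogDensity θ a b p σ (n + k) := by
  induction k with
  | zero => simp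
  | succ k ih =>
    rw [← add_assoc n k 1, Finset.sum_Ico_succ_top (Nat.le_add_right n k), ← add_assoc]
    exact (add_le_add_left ih _).trans
      (moranLogDensity_add_moranMinIncr_le ha hb hp θ σ (n + k))

theorem exists_moranLogDensity_eq_sum_moranMinIncr (ha : ∀ n, 0 < a n) (hb : ∀ n, 0 < b n)
    (hp : ∀ n, (p n : ℝ) ∈ Ioo (0 : ℝ) 1) (θ : ℝ) :
    ∃ σ : ℕ → Bool, ∀ n, moranLogDensity θ a b p σ n =
      ∑ i ∈ Finset.range n, moranMinIncr θ (a i) (b i) (p i) := by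
  classical
  refine ⟨fun i => decide (Real.log (1 - p i) - θ * Real.log (b i) ≤
    Real.log (p i) - θ * Real.log (a i)), fun n => ?_⟩
  induction n with
  | zero => simp [moranLogDensity, moranMass, moranLength]
  | succ n ih =>
    rw [moranLogDensity_succ ha hb hp, ih, Finset.sum_range_succ]
    simp only [decide_eq_true_eq, add_right_inj, moranMinIncr]
    split_ifs with hle
    · rw [min_eq_right hle]
    · rw [min_eq_left (le_of_not_ge hle)]

theorem moranMass_le_rpow_moranLength (ha : ∀ n, 0 < a n) (hb : ∀ n, 0 < b n)
    (hp : ∀ n, (p n : ℝ) ∈ Ioo (0 : ℝ) 1) {θ : ℝ} {σ : ℕ → Bool} {n : ℕ}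
    (h : moranLogDensity θ a b p σ n ≤ 0) : moranMass p σ n ≤ moranLength a b σ n ^ θ := by
  have hlength := moranLength_pos ha hb σ n
  rw [← Real.log_le_log_iff (moranMass_pos hp σ n) (by positivity), Real.log_rpow hlength]
  exact sub_nonpos.1 h

theorem moranMass_div_le_rpow_moranLength_div (ha : ∀ n, 0 < a n) (hb : ∀ n, 0 < b n)
    (hp : ∀ n, (p n : ℝ) ∈ Ioo (0 : ℝ) 1) {θ : ℝ} {σ : ℕ → Bool} {n m : ℕ}
    (h : moranLogDensity θ a b p σ n ≤ moranLogDensity θ a b p σ m) :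
    moranMass p σ n / moranMass p σ m ≤ (moranLength a b σ n / moranLength a b σ m) ^ θ := by
  have hmass := moranMass_pos hp σ
  have hlength := moranLength_pos ha hb σ
  have hratio : 0 < moranLength a b σ n / moranLength a b σ m := div_pos (hlength n) (hlength m)
  rw [← Real.log_le_log_iff (div_pos (hmass n) (hmass m)) (Real.rpow_pos_of_pos hratio θ),
    Real.log_rpow hratio, Real.log_div (hmass n).ne' (hmass m).ne',
    Real.log_div (hlength n).ne' (hlength m).ne']
  simp only [moranLogDensity] at h
  linarith

end LogDensity

/-- Ratio sequences of a Moran construction with all ratios at least `A` and all sums of the two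
ratios at most `B < 1`. -/
structure IsMoranRatios (A B : ℝ) (a b : ℕ → ℝ) : Prop where
  A_pos : 0 < A
  B_lt_one : B < 1
  le_a : ∀ n, A ≤ a n
  le_b : ∀ n, A ≤ b n
  add_le : ∀ n, a n + b n ≤ B

namespace IsMoranRatios

variable {A B : ℝ} {a b : ℕ → ℝ}

theorem a_pos (h : IsMoranRatios A B a b) (n : ℕ) : 0 < a n := h.A_pos.trans_le (h.le_a n)

theorem b_pos (h : IsMoranRatios A B a b) (n : ℕ) : 0 < b n := h.A_pos.trans_le (h.le_b n)

theorem add_lt_one (h : IsMoranRatios A B a b) (n : ℕ) : a n + b n < 1 :=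
  (h.add_le n).trans_lt h.B_lt_one

theorem a_le (h : IsMoranRatios A B a b) (n : ℕ) : a n ≤ B :=
  (le_add_of_nonneg_right (h.b_pos n).le).trans (h.add_le n)

theorem b_le (h : IsMoranRatios A B a b) (n : ℕ) : b n ≤ B :=
  (le_add_of_nonneg_left (h.a_pos n).le).trans (h.add_le n)

theorem B_mem_Ioo (h : IsMoranRatios A B a b) : B ∈ Ioo (0 : ℝ) 1 :=
  ⟨(h.a_pos 0).trans_le (h.a_le 0), h.B_lt_one⟩

theorem A_mem_Ioo (h : IsMoranRatios A B a b) : A ∈ Ioo (0 : ℝ) 1 :=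
  ⟨h.A_pos, ((h.le_a 0).trans (h.a_le 0)).trans_lt h.B_lt_one⟩

theorem one_sub_B_pos (h : IsMoranRatios A B a b) : 0 < 1 - B := sub_pos.2 h.B_lt_one

/-! ### Lengths of Moran intervals -/

theorem length_pos (h : IsMoranRatios A B a b) (σ : ℕ → Bool) (n : ℕ) : 0 < moranLength a b σ n :=
  moranLength_pos h.a_pos h.b_pos σ n

theorem length_succ_le (h : IsMoranRatios A B a b) (σ : ℕ → Bool) (n : ℕ) :
    moranLength a b σ (n + 1) ≤ B * moranLength a b σ n := by
  refine mul_le_mul_of_nonneg_right ?_ (h.length_pos σ n).le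
  split_ifs
  · exact h.b_le n
  · exact h.a_le n

theorem le_length_succ (h : IsMoranRatios A B a b) (σ : ℕ → Bool) (n : ℕ) :
    A * moranLength a b σ n ≤ moranLength a b σ (n + 1) := by
  refine mul_le_mul_of_nonneg_right ?_ (h.length_pos σ n).le
  split_ifs
  · exact h.le_b n
  · exact h.le_a n

theorem length_antitone (h : IsMoranRatios A B a b) (σ : ℕ → Bool) : Antitone (moranLength a b σ) :=
  antitone_nat_of_succ_le fun n => (h.length_succ_le σ n).trans
    (mul_le_of_le_one_left (h.length_pos σ n).le h.B_lt_one.le)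

theorem length_le_pow (h : IsMoranRatios A B a b) (σ : ℕ → Bool) (n : ℕ) :
    moranLength a b σ n ≤ B ^ n := by
  induction n with
  | zero => exact (pow_zero B).ge
  | succ n ih =>
    rw [pow_succ']
    exact (h.length_succ_le σ n).trans (mul_le_mul_of_nonneg_left ih h.B_mem_Ioo.1.le)

theorem pow_mul_length_le (h : IsMoranRatios A B a b) (σ : ℕ → Bool) (n k : ℕ) :
    A ^ k * moranLength a b σ n ≤ moranLength a b σ (n + k) := by
  induction k with
  | zero => simp
  | succ k ih =>
    rw [pow_succ', mul_assoc]
    exact (mul_le_mul_of_nonneg_left ih h.A_pos.le).trans (h.le_length_succ σ (n + k))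

theorem pow_le_length (h : IsMoranRatios A B a b) (σ : ℕ → Bool) (n : ℕ) :
    A ^ n ≤ moranLength a b σ n := by
  simpa only [moranLength, mul_one, zero_add] using h.pow_mul_length_le σ 0 n

theorem tendsto_length (h : IsMoranRatios A B a b) (σ : ℕ → Bool) :
    Tendsto (moranLength a b σ) atTop (𝓝 0) :=
  squeeze_zero (fun n => (h.length_pos σ n).le) (h.length_le_pow σ)
    (tendsto_pow_atTop_nhds_zero_of_lt_one h.B_mem_Ioo.1.le h.B_lt_one)

theorem exists_length_lt (h : IsMoranRatios A B a b) (σ : ℕ → Bool) {ε : ℝ} (hε : 0 < ε) :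
    ∃ n, moranLength a b σ n < ε :=
  ((h.tendsto_length σ).eventually_lt_const hε).exists

theorem exists_length_succ_lt_le (h : IsMoranRatios A B a b) (σ : ℕ → Bool) {ρ : ℝ} (hρ : 0 < ρ)
    (hρ1 : ρ ≤ 1) : ∃ n, moranLength a b σ (n + 1) < ρ ∧ ρ ≤ moranLength a b σ n := by
  obtain ⟨n, hn, hn'⟩ := Nat.exists_not_and_succ_of_not_zero_of_exists
    (p := fun n => moranLength a b σ n < ρ) (not_lt.2 hρ1) (h.exists_length_lt σ hρ)
  exact ⟨n, hn', not_lt.1 hn⟩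

theorem exists_scales (h : IsMoranRatios A B a b) (σ : ℕ → Bool) {r R : ℝ} (hr : 0 < r)
    (hrR : r < R) (hR : R ≤ 1 - B) :
    ∃ n k, R ≤ (1 - B) * moranLength a b σ n ∧ (1 - B) * A * moranLength a b σ n < R ∧
      moranLength a b σ (n + k) < r ∧ A * r ≤ moranLength a b σ (n + k) := by
  have hB := h.one_sub_B_pos
  have hr1 : r ≤ 1 := by linarith [h.B_mem_Ioo.1]
  obtain ⟨n, hn, hn'⟩ :=
    h.exists_length_succ_lt_le σ (div_pos (hr.trans hrR) hB) ((div_le_one hB).2 hR)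
  obtain ⟨m, hm, hm'⟩ := h.exists_length_succ_lt_le σ hr hr1
  rw [lt_div_iff₀' hB] at hn
  rw [div_le_iff₀' hB] at hn'
  have hRn : R ≤ moranLength a b σ n :=
    hn'.trans (mul_le_of_le_one_left (h.length_pos σ n).le (sub_le_self 1 h.B_mem_Ioo.1.le))
  have hnm : n ≤ m + 1 := (h.length_antitone σ).reflect_lt (hm.trans (hrR.trans_le hRn)) |>.le
  obtain ⟨k, hk⟩ := Nat.exists_eq_add_of_le hnm
  rw [hk] at hm
  refine ⟨n, k, hn', ?_, hm, hk ▸ ?_⟩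
  · rw [mul_assoc]
    exact (mul_le_mul_of_nonneg_left (h.le_length_succ σ n) hB.le).trans_lt hn
  · exact (mul_le_mul_of_nonneg_left hm' h.A_pos.le).trans (h.le_length_succ σ m)

/-! ### Points, support and balls of the Moran measure -/

theorem gap_le_dist (h : IsMoranRatios A B a b) {σ τ : ℕ → Bool} (hne : σ ≠ τ) :
    (1 - B) * moranLength a b σ (PiNat.firstDiff σ τ) ≤
      dist (moranPoint a b σ) (moranPoint a b τ) := by
  set k := PiNat.firstDiff σ τ
  have hdiff : σ k ≠ τ k := PiNat.apply_firstDiff_ne hne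
  obtain ⟨hleft, hlength⟩ := moranInterval_congr (a := a) (b := b) (σ := σ) (τ := τ) (n := k)
    fun i hi => (PiNat.apply_eq_of_lt_firstDiff hi).symm
  have hσmem := moranPoint_mem h.a_pos h.b_pos h.add_lt_one σ (k + 1)
  have hτmem := moranPoint_mem h.a_pos h.b_pos h.add_lt_one τ (k + 1)
  have hgap : (1 - B) * moranLength a b σ k ≤ (1 - a k - b k) * moranLength a b σ k :=
    mul_le_mul_of_nonneg_right (by linarith [h.add_le k]) (h.length_pos σ k).le
  simp only [moranInterval, moranLeft, moranLength, mem_Icc, hleft, hlength] at hσmem hτmem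
  rw [Real.dist_eq]
  rcases hσ : σ k with _ | _ <;> rcases hτ : τ k with _ | _ <;>
    simp only [hσ, hτ, if_true, if_false, Bool.false_eq_true, ne_eq, not_true] at *
  · exact le_trans (by linarith) (neg_le_abs _)
  · exact le_trans (by linarith) (le_abs_self _)

theorem mem_cylinder_of_dist_lt (h : IsMoranRatios A B a b) {σ τ : ℕ → Bool} {n : ℕ}
    (hdist : dist (moranPoint a b σ) (moranPoint a b τ) < (1 - B) * moranLength a b σ n) :
    τ ∈ PiNat.cylinder σ n := by
  rcases eq_or_ne σ τ with rfl | hne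
  · exact PiNat.self_mem_cylinder σ n
  rw [PiNat.mem_cylinder_comm, PiNat.mem_cylinder_iff_le_firstDiff hne]
  exact ((h.length_antitone σ).reflect_lt
    (lt_of_mul_lt_mul_left ((h.gap_le_dist hne).trans_lt hdist) h.one_sub_B_pos.le)).le

theorem dist_le_length (h : IsMoranRatios A B a b) {σ : ℕ → Bool} {n : ℕ} {x : ℝ}
    (hx : x ∈ moranInterval a b σ n) : dist x (moranPoint a b σ) ≤ moranLength a b σ n := by
  simpa only [add_sub_cancel_left] using
    Real.dist_le_of_mem_Icc hx (moranPoint_mem h.a_pos h.b_pos h.add_lt_one σ n)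

theorem continuous_moranPoint (h : IsMoranRatios A B a b) : Continuous (moranPoint a b) := by
  refine continuous_iff_continuousAt.2 fun σ => Metric.tendsto_nhds.2 fun ε hε => ?_
  obtain ⟨n, hn⟩ := h.exists_length_lt σ hε
  filter_upwards [(PiNat.isOpen_cylinder _ σ n).mem_nhds (PiNat.self_mem_cylinder σ n)] with τ hτ
  refine (h.dist_le_length ?_).trans_lt hn
  exact (moranPoint_mem_iff h.a_pos h.b_pos h.add_lt_one σ τ n).2 (PiNat.mem_cylinder_iff.1 hτ)

theorem support_moranMeasure_subset (h : IsMoranRatios A B a b) (p : ℕ → unitInterval) :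
    (moranMeasure a b p).support ⊆ range (moranPoint a b) := by
  have hclosed : IsClosed (range (moranPoint a b)) :=
    (isCompact_range h.continuous_moranPoint).isClosed
  exact Measure.support_subset_of_isClosed hclosed (ae_map_mem_range _ hclosed.measurableSet _)

variable {p : ℕ → unitInterval} {σ : ℕ → Bool} {n : ℕ}

theorem measure_moranInterval (h : IsMoranRatios A B a b) :
    moranMeasure a b p (moranInterval a b σ n) = ENNReal.ofReal (moranMass p σ n) := by
  rw [moranMeasure_moranInterval h.a_pos h.b_pos h.add_lt_one, moranMass,
    ENNReal.ofReal_prod_of_nonneg]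
  intro i _
  split_ifs
  · exact sub_nonneg.2 (p i).2.2
  · exact (p i).2.1

theorem measure_ball_le (h : IsMoranRatios A B a b) {R : ℝ}
    (hR : R ≤ (1 - B) * moranLength a b σ n) :
    moranMeasure a b p (Metric.ball (moranPoint a b σ) R) ≤ ENNReal.ofReal (moranMass p σ n) := by
  rw [← h.measure_moranInterval, moranMeasure,
    Measure.map_apply measurable_moranPoint measurableSet_ball,
    Measure.map_apply measurable_moranPoint (by exact measurableSet_Icc)]
  refine measure_mono fun τ hτ => ?_
  rw [mem_preimage, Metric.mem_ball'] at hτ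
  exact (moranPoint_mem_iff h.a_pos h.b_pos h.add_lt_one σ τ n).2
    (PiNat.mem_cylinder_iff.1 (h.mem_cylinder_of_dist_lt (hτ.trans_le hR)))

theorem le_measure_ball (h : IsMoranRatios A B a b) {r : ℝ} (hr : moranLength a b σ n < r) :
    ENNReal.ofReal (moranMass p σ n) ≤ moranMeasure a b p (Metric.ball (moranPoint a b σ) r) := by
  rw [← h.measure_moranInterval]
  exact measure_mono fun x hx => (h.dist_le_length hx).trans_lt hr

theorem moranPoint_mem_support (h : IsMoranRatios A B a b)
    (hp : ∀ n, (p n : ℝ) ∈ Ioo (0 : ℝ) 1) (σ : ℕ → Bool) :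
    moranPoint a b σ ∈ (moranMeasure a b p).support := by
  refine (Measure.mem_support_iff_forall _).2 fun U hU => ?_
  obtain ⟨ε, hε, hsub⟩ := Metric.mem_nhds_iff.1 hU
  obtain ⟨n, hn⟩ := h.exists_length_lt σ hε
  exact (ENNReal.ofReal_pos.2 (moranMass_pos hp σ n)).trans_le
    ((h.le_measure_ball hn).trans (measure_mono hsub))

/-! ### Dimension bounds for a fixed Moran measure -/

theorem le_upperPhiDim (h : IsMoranRatios A B a b) (hp : ∀ n, (p n : ℝ) ∈ Ioo (0 : ℝ) 1)
    {Φ : ℝ → ℝ} (hΦ : ∀ᶠ t in 𝓝[>] 0, 0 ≤ Φ t) {θ : ℝ}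
    (hsum : ∃ᶠ n in atTop, ∑ i ∈ Finset.range n, moranMinIncr θ (a i) (b i) (p i) ≤ 0) :
    (θ : EReal) ≤ upperPhiDim Φ (moranMeasure a b p) := by
  obtain ⟨σ, hσ⟩ := exists_moranLogDensity_eq_sum_moranMinIncr h.a_pos h.b_pos hp θ
  have hB := h.one_sub_B_pos
  refine le_upperPhiDim_of_frequently_measure_ball_le hΦ (h.moranPoint_mem_support hp σ)
    (C := ((1 - B) ^ θ)⁻¹) ?_
  have hradius : Tendsto (fun n => (1 - B) * moranLength a b σ n) atTop (𝓝[>] 0) := by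
    refine tendsto_nhdsWithin_iff.2
      ⟨?_, Eventually.of_forall fun n => mul_pos hB (h.length_pos σ n)⟩
    simpa only [mul_zero] using (h.tendsto_length σ).const_mul (1 - B)
  refine hradius.frequently (hsum.mono fun n hn => (h.measure_ball_le le_rfl).trans ?_)
  rw [Real.mul_rpow hB.le (h.length_pos σ n).le,
    inv_mul_cancel_left₀ (Real.rpow_pos_of_pos hB θ).ne']
  exact ENNReal.ofReal_le_ofReal
    (moranMass_le_rpow_moranLength h.a_pos h.b_pos hp ((hσ n).trans_le hn))

theorem measure_ball_div_le (h : IsMoranRatios A B a b) (hp : ∀ n, (p n : ℝ) ∈ Ioo (0 : ℝ) 1)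
    {θ : ℝ} (hθ : 0 ≤ θ) {r R : ℝ} (hr : 0 < r) (hrR : r < R) (hR : R ≤ 1 - B)
    (hsum : ∀ n k : ℕ, R ≤ B ^ n → (1 - B) * A * A ^ n < R → A ^ k ≤ r / R →
      0 ≤ ∑ i ∈ Finset.Ico n (n + k), moranMinIncr θ (a i) (b i) (p i)) :
    moranMeasure a b p (Metric.ball (moranPoint a b σ) R) /
        moranMeasure a b p (Metric.ball (moranPoint a b σ) r) ≤
      ENNReal.ofReal ((1 / ((1 - B) * A * A)) ^ θ * (R / r) ^ θ) := by
  have hA := h.A_pos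
  have hB := h.one_sub_B_pos
  obtain ⟨n, k, hRn, hnR, hkr, hrk⟩ := h.exists_scales σ hr hrR hR
  have hn := h.length_pos σ n
  have hk := h.length_pos σ (n + k)
  have hR0 : 0 < R := hr.trans hrR
  have hRn' : R ≤ moranLength a b σ n :=
    hRn.trans (mul_le_of_le_one_left hn.le (sub_le_self 1 h.B_mem_Ioo.1.le))
  have hgap : A ^ k ≤ r / R := by
    rw [le_div_iff₀ hR0]
    calc A ^ k * R ≤ A ^ k * moranLength a b σ n := by gcongr
      _ ≤ r := (h.pow_mul_length_le σ n k).trans hkr.le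
  have hblock := hsum n k (hRn'.trans (h.length_le_pow σ n))
    ((mul_le_mul_of_nonneg_left (h.pow_le_length σ n) (by positivity)).trans_lt hnR) hgap
  have hdensity : moranLogDensity θ a b p σ n ≤ moranLogDensity θ a b p σ (n + k) :=
    (le_add_of_nonneg_right hblock).trans
      (moranLogDensity_add_sum_moranMinIncr_le h.a_pos h.b_pos hp θ σ n k)
  have hlength : moranLength a b σ n / moranLength a b σ (n + k) ≤
      1 / ((1 - B) * A * A) * (R / r) := by
    rw [div_mul_div_comm, one_mul, div_le_div_iff₀ hk (by positivity)]
    calc moranLength a b σ n * ((1 - B) * A * A * r)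
        = ((1 - B) * A * moranLength a b σ n) * (A * r) := by ring
      _ ≤ R * moranLength a b σ (n + k) := by gcongr
  rw [← Real.mul_rpow (by positivity) (by positivity)]
  calc _ ≤ ENNReal.ofReal (moranMass p σ n) / ENNReal.ofReal (moranMass p σ (n + k)) :=
        ENNReal.div_le_div (h.measure_ball_le hRn) (h.le_measure_ball hkr)
    _ = ENNReal.ofReal (moranMass p σ n / moranMass p σ (n + k)) :=
        (ENNReal.ofReal_div_of_pos (moranMass_pos hp σ (n + k))).symm
    _ ≤ _ := ENNReal.ofReal_le_ofReal
        ((moranMass_div_le_rpow_moranLength_div h.a_pos h.b_pos hp hdensity).trans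
          (Real.rpow_le_rpow (by positivity) hlength hθ))

theorem upperPhiDim_le (h : IsMoranRatios A B a b) (hp : ∀ n, (p n : ℝ) ∈ Ioo (0 : ℝ) 1)
    {Φ : ℝ → ℝ} (hΦ : IsLargeDimensionFunction Φ) {θ K : ℝ} (hθ : 0 ≤ θ) (hK : 0 ≤ K)
    (hsum : ∀ᶠ n : ℕ in atTop, ∀ k : ℕ, K * Real.log n ≤ k →
      0 ≤ ∑ i ∈ Finset.Ico n (n + k), moranMinIncr θ (a i) (b i) (p i)) :
    upperPhiDim Φ (moranMeasure a b p) ≤ θ := by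
  have hA := h.A_mem_Ioo
  have hB := h.one_sub_B_pos
  obtain ⟨N, hN⟩ := eventually_atTop.1 hsum
  have hpow : 0 < (1 - B) * A * A ^ N := mul_pos (mul_pos hB hA.1) (pow_pos hA.1 N)
  obtain ⟨C, hC, hsub⟩ := mem_nhdsGT_iff_exists_Ioc_subset.1
    ((hΦ.eventually_mul_log_le hA h.B_mem_Ioo hK).and
      (Ioo_mem_nhdsGT (lt_min hB hpow)))
  refine sInf_le ⟨θ, rfl, C, hC, (1 / ((1 - B) * A * A)) ^ θ,
    Real.rpow_pos_of_pos (one_div_pos.2 (mul_pos (mul_pos hB hA.1) hA.1)) θ, ?_⟩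
  intro r R hr hrR hRR hRC _ x hx
  have hR0 : 0 < R := hr.trans (hrR.trans_le hRR)
  obtain ⟨hlog, -, hRsmall⟩ := hsub ⟨hR0, hRC⟩
  obtain ⟨hRB, hRN⟩ := lt_min_iff.1 hRsmall
  obtain ⟨σ, rfl⟩ := h.support_moranMeasure_subset p hx
  refine h.measure_ball_div_le hp hθ hr (hrR.trans_le hRR) hRB.le fun n k hn hnR hk => ?_
  refine hN n ?_ k (hlog n k hn (hk.trans ?_))
  · refine ((pow_lt_pow_iff_right_of_lt_one₀ hA.1 hA.2).1 ?_).le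
    exact lt_of_mul_lt_mul_left (hnR.trans hRN) (mul_pos hB hA.1).le
  · rw [Real.rpow_add hR0, Real.rpow_one] at hrR
    exact (div_le_iff₀' hR0).2 hrR.le

end IsMoranRatios

/-! ### Sequences of independent pairs -/

section Pairs

variable {Ω ι : Type*} [MeasurableSpace Ω] {P : Measure Ω} {E F : ι → Type*}
  [∀ i, MeasurableSpace (E i)] [∀ i, MeasurableSpace (F i)]
  {X : ∀ i, Ω → E i} {Y : ∀ i, Ω → F i}

theorem measure_biInter_preimage_inter_preimage (hX : iIndepFun X P) (hY : iIndepFun Y P)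
    (hXY : IndepFun (fun ω i => X i ω) (fun ω i => Y i ω) P) {s : Finset ι}
    {U : ∀ i, Set (E i)} {V : ∀ i, Set (F i)} (hU : ∀ i ∈ s, MeasurableSet (U i))
    (hV : ∀ i ∈ s, MeasurableSet (V i)) :
    P (⋂ i ∈ s, X i ⁻¹' U i ∩ Y i ⁻¹' V i) =
      (∏ i ∈ s, P (X i ⁻¹' U i)) * ∏ i ∈ s, P (Y i ⁻¹' V i) := by
  have hpreX : (fun ω i => X i ω) ⁻¹' (s : Set ι).pi U = ⋂ i ∈ s, X i ⁻¹' U i := by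
    ext ω
    simp only [mem_preimage, Set.mem_pi, Finset.mem_coe, mem_iInter]
  have hpreY : (fun ω i => Y i ω) ⁻¹' (s : Set ι).pi V = ⋂ i ∈ s, Y i ⁻¹' V i := by
    ext ω
    simp only [mem_preimage, Set.mem_pi, Finset.mem_coe, mem_iInter]
  have h := hXY.measure_inter_preimage_eq_mul _ _ (MeasurableSet.pi s.countable_toSet hU)
    (MeasurableSet.pi s.countable_toSet hV)
  rw [hpreX, hpreY, hX.measure_inter_preimage_eq_mul s hU,
    hY.measure_inter_preimage_eq_mul s hV] at h
  simp only [iInter_inter_distrib, h]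

theorem iIndepFun_prodMk_of_indepFun (hX_meas : ∀ i, Measurable (X i))
    (hY_meas : ∀ i, Measurable (Y i)) (hX : iIndepFun X P) (hY : iIndepFun Y P)
    (hXY : IndepFun (fun ω i => X i ω) (fun ω i => Y i ω) P) :
    iIndepFun (fun i ω => (X i ω, Y i ω)) P := by
  rw [iIndepFun_iff_iIndep]
  refine iIndepSets.iIndep (fun i => ((hX_meas i).prodMk (hY_meas i)).comap_le)
    (fun i => preimage (fun ω => (X i ω, Y i ω)) ''
      image2 (· ×ˢ ·) {s | MeasurableSet s} {t | MeasurableSet t})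
    (fun i => isPiSystem_prod.comap _)
    (fun i => by rw [← MeasurableSpace.comap_generateFrom, generateFrom_prod])
    ((iIndepSets_iff _ _).2 fun s f hf => ?_)
  have hrect (i : ι) : ∃ U V, i ∈ s → MeasurableSet U ∧ MeasurableSet V ∧
      f i = X i ⁻¹' U ∩ Y i ⁻¹' V := by
    by_cases hi : i ∈ s
    · obtain ⟨_, ⟨U, hU, V, hV, rfl⟩, hUV⟩ := hf i hi
      exact ⟨U, V, fun _ => ⟨hU, hV, hUV.symm⟩⟩
    · exact ⟨∅, ∅, fun h => absurd h hi⟩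
  choose U V hUV using hrect
  have hU i (hi : i ∈ s) : MeasurableSet (U i) := (hUV i hi).1
  have hV i (hi : i ∈ s) : MeasurableSet (V i) := (hUV i hi).2.1
  have hf_eq i (hi : i ∈ s) : f i = X i ⁻¹' U i ∩ Y i ⁻¹' V i := (hUV i hi).2.2
  rw [iInter₂_congr hf_eq, measure_biInter_preimage_inter_preimage hX hY hXY hU hV,
    ← Finset.prod_mul_distrib]
  refine Finset.prod_congr rfl fun i hi => ?_
  have hXYi : IndepFun (X i) (Y i) P := hXY.comp (measurable_pi_apply i) (measurable_pi_apply i)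
  rw [hf_eq i hi, hXYi.measure_inter_preimage_eq_mul _ _ (hU i hi) (hV i hi)]

end Pairs

/-! ### Sums of independent identically distributed variables -/

section Sums

variable {Ω : Type*} [MeasurableSpace Ω] {P : Measure Ω}

theorem exists_mgf_lt_one [IsProbabilityMeasure P] {X : Ω → ℝ}
    (hexp : 0 ∈ interior (integrableExpSet X P)) (hmean : 0 < ∫ ω, X ω ∂P) :
    ∃ s < 0, s ∈ integrableExpSet X P ∧ mgf X P s < 1 := by
  have hderiv : HasDerivAt (mgf X P) (∫ ω, X ω ∂P) 0 := by
    simpa only [zero_mul, Real.exp_zero, mul_one] using hasDerivAt_mgf hexp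
  have hslope : ∀ᶠ s in 𝓝[<] (0 : ℝ), 0 < slope (mgf X P) 0 s :=
    ((hasDerivAt_iff_tendsto_slope.1 hderiv).mono_left
      (nhdsWithin_mono _ fun _ => ne_of_lt)).eventually_const_lt hmean
  have hset : ∀ᶠ s in 𝓝[<] (0 : ℝ), s ∈ integrableExpSet X P :=
    nhdsWithin_le_nhds (mem_interior_iff_mem_nhds.1 hexp)
  obtain ⟨s, hs_slope, hs, hs0⟩ := (hslope.and (hset.and self_mem_nhdsWithin)).exists
  refine ⟨s, hs0, hs, ?_⟩
  rw [slope_def_field, mgf_zero, sub_zero] at hs_slope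
  by_contra! hge
  exact hs_slope.not_ge (div_nonpos_of_nonneg_of_nonpos (sub_nonneg.2 hge) (le_of_lt hs0))

theorem measureReal_sum_nonpos_le_mgf_pow {ι : Type*} [IsFiniteMeasure P] {X : ι → Ω → ℝ}
    {Z : Ω → ℝ} (hX : ∀ i, Measurable (X i)) (hindep : iIndepFun X P)
    (hident : ∀ i, IdentDistrib (X i) Z P P) {s : ℝ} (hs0 : s ≤ 0)
    (hs : s ∈ integrableExpSet Z P) (I : Finset ι) :
    P.real {ω | ∑ i ∈ I, X i ω ≤ 0} ≤ mgf Z P s ^ I.card := by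
  have hint (i : ι) : Integrable (fun ω => Real.exp (s * X i ω)) P :=
    ((hident i).comp (measurable_const_mul s).exp).integrable_iff.2 hs
  have hchernoff := measure_le_le_exp_mul_mgf 0 hs0
    (hindep.integrable_exp_mul_sum hX (s := I) fun i _ => hint i)
  simpa only [Finset.sum_apply, mul_zero, Real.exp_zero, one_mul, hindep.mgf_sum hX,
    mgf_congr_of_identDistrib _ Z (hident _), Finset.prod_const] using hchernoff

/-- Half of the exponential decay pays for the summability over the starting index `n`. -/
theorem pow_le_inv_sq_mul_sqrt_pow {ρ : ℝ} (hρ : ρ ∈ Ioo (0 : ℝ) 1) {n k : ℕ} (hn : n ≠ 0)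
    (hk : 4 / -Real.log ρ * Real.log n ≤ k) : ρ ^ k ≤ ((n : ℝ) ^ 2)⁻¹ * √ρ ^ k := by
  have hρ0 : 0 < ρ := hρ.1
  have hsqrt : √ρ ^ k ≤ ((n : ℝ) ^ 2)⁻¹ := by
    rw [div_mul_eq_mul_div, div_le_iff₀ (neg_pos.2 (Real.log_neg hρ.1 hρ.2))] at hk
    rw [← Real.log_le_log_iff (by positivity) (by positivity), Real.log_pow, Real.log_inv,
      Real.log_pow, Real.log_sqrt hρ0.le]
    push_cast
    linarith
  calc ρ ^ k = √ρ ^ k * √ρ ^ k := by rw [← mul_pow, Real.mul_self_sqrt hρ0.le]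
    _ ≤ ((n : ℝ) ^ 2)⁻¹ * √ρ ^ k := by gcongr

theorem ae_eventually_forall_notMem_of_measure_le_pow {S : ℕ → ℕ → Set Ω} {ρ : ℝ}
    (hρ : ρ ∈ Ioo (0 : ℝ) 1) (hS : ∀ n k, P (S n k) ≤ ENNReal.ofReal (ρ ^ k)) :
    ∀ᵐ ω ∂P, ∀ᶠ n : ℕ in atTop, ∀ k : ℕ, 4 / -Real.log ρ * Real.log n ≤ k → ω ∉ S n k := by
  let T : ℕ × ℕ → Set Ω := fun q =>
    {ω | (q.1 ≠ 0 ∧ 4 / -Real.log ρ * Real.log q.1 ≤ q.2) ∧ ω ∈ S q.1 q.2}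
  let F : ℕ × ℕ → ℝ := fun q => ((q.1 : ℝ) ^ 2)⁻¹ * √ρ ^ q.2
  have hsqrt : √ρ < 1 := (Real.sqrt_lt' one_pos).2 (hρ.2.trans_eq (one_pow 2).symm)
  have hF : Summable F :=
    (Real.summable_nat_pow_inv.2 one_lt_two).mul_of_nonneg
      (summable_geometric_of_lt_one (Real.sqrt_nonneg ρ) hsqrt)
      (fun _ => by positivity) (fun _ => by positivity)
  have hT (q : ℕ × ℕ) : P (T q) ≤ ENNReal.ofReal (F q) := by
    by_cases hq : q.1 ≠ 0 ∧ 4 / -Real.log ρ * Real.log q.1 ≤ q.2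
    · exact (measure_mono fun ω hω => hω.2).trans ((hS q.1 q.2).trans
        (ENNReal.ofReal_le_ofReal (pow_le_inv_sq_mul_sqrt_pow hρ hq.1 hq.2)))
    · rw [show T q = ∅ from eq_empty_of_forall_notMem fun ω hω => hq hω.1, measure_empty]
      exact zero_le
  have hsum : ∑' q, P (T q) ≠ ∞ :=
    ne_top_of_le_ne_top hF.tsum_ofReal_ne_top (ENNReal.tsum_le_tsum hT)
  filter_upwards [ae_finite_setOfPred_mem hsum] with ω hω
  obtain ⟨N, hN⟩ := (hω.image Prod.fst).bddAbove
  filter_upwards [eventually_gt_atTop N] with n hn k hk hmem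
  exact hn.not_ge (hN ⟨(n, k), ⟨⟨Nat.ne_zero_of_lt hn, hk⟩, hmem⟩, rfl⟩)

theorem exists_ae_eventually_sum_Ico_pos [IsProbabilityMeasure P] {X : ℕ → Ω → ℝ}
    (hX : ∀ i, Measurable (X i)) (hindep : iIndepFun X P)
    (hident : ∀ i, IdentDistrib (X i) (X 0) P P)
    (hexp : 0 ∈ interior (integrableExpSet (X 0) P)) (hmean : 0 < ∫ ω, X 0 ω ∂P) :
    ∃ K ≥ 0, ∀ᵐ ω ∂P, ∀ᶠ n : ℕ in atTop, ∀ k : ℕ, K * Real.log n ≤ k →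
      0 < ∑ i ∈ Finset.Ico n (n + k), X i ω := by
  obtain ⟨s, hs0, hs, hlt⟩ := exists_mgf_lt_one hexp hmean
  have hρ : mgf (X 0) P s ∈ Ioo (0 : ℝ) 1 := ⟨mgf_pos hs, hlt⟩
  have hlog := Real.log_neg hρ.1 hρ.2
  refine ⟨4 / -Real.log (mgf (X 0) P s), div_nonneg zero_le_four (neg_nonneg.2 hlog.le), ?_⟩
  have htail (n k : ℕ) : P {ω | ∑ i ∈ Finset.Ico n (n + k), X i ω ≤ 0} ≤
      ENNReal.ofReal (mgf (X 0) P s ^ k) := by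
    have h := measureReal_sum_nonpos_le_mgf_pow hX hindep hident hs0.le hs (Finset.Ico n (n + k))
    rw [Nat.card_Ico, Nat.add_sub_cancel_left] at h
    rw [← ofReal_measureReal]
    exact ENNReal.ofReal_le_ofReal h
  filter_upwards [ae_eventually_forall_notMem_of_measure_le_pow hρ htail] with ω hω
  filter_upwards [hω] with n hn k hk
  exact not_le.1 (hn k hk)

theorem ae_eventually_sum_range_neg {X : ℕ → Ω → ℝ} (hint : Integrable (X 0) P)
    (hindep : Pairwise fun i j => IndepFun (X i) (X j) P)
    (hident : ∀ i, IdentDistrib (X i) (X 0) P P) (hmean : ∫ ω, X 0 ω ∂P < 0) :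
    ∀ᵐ ω ∂P, ∀ᶠ n in atTop, ∑ i ∈ Finset.range n, X i ω < 0 := by
  filter_upwards [strong_law_ae_real X hint hindep hident] with ω hω
  filter_upwards [hω.eventually_lt_const hmean] with n hn
  exact neg_of_div_neg_left hn n.cast_nonneg

end Sums

/-! ### Exponential moments -/

section ExponentialMoments

variable {Ω : Type*} [MeasurableSpace Ω] {P : Measure Ω} {X Y f : Ω → ℝ} {s t : ℝ}

theorem mem_integrableExpSet_min (hX : s ∈ integrableExpSet X P)
    (hY : s ∈ integrableExpSet Y P) : s ∈ integrableExpSet (fun ω => min (X ω) (Y ω)) P := by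
  simp only [integrableExpSet, mem_ofPred_eq] at *
  rcases le_total 0 s with hs | hs
  · have hmono : Monotone fun x => Real.exp (s * x) := fun x y hxy =>
      Real.exp_le_exp.2 (mul_le_mul_of_nonneg_left hxy hs)
    exact (hX.inf hY).congr (ae_of_all _ fun ω => hmono.map_min.symm)
  · have hanti : Antitone fun x => Real.exp (s * x) := fun x y hxy =>
      Real.exp_le_exp.2 (mul_le_mul_of_nonpos_left hxy hs)
    exact (hX.sup hY).congr (ae_of_all _ fun ω => hanti.map_min.symm)

theorem mem_integrableExpSet_sub_of_bounded (hX : s ∈ integrableExpSet X P)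
    (hY : AEMeasurable Y P) {C : ℝ} (hC : ∀ᵐ ω ∂P, |Y ω| ≤ C) :
    s ∈ integrableExpSet (fun ω => X ω - Y ω) P := by
  simp only [integrableExpSet, mem_ofPred_eq, mul_sub, sub_eq_add_neg (s * X _),
    Real.exp_add] at *
  refine hX.mul_bdd (c := Real.exp (|s| * C))
    (hY.const_mul s).neg.exp.aestronglyMeasurable ?_
  filter_upwards [hC] with ω hω
  rw [Real.norm_eq_abs, Real.abs_exp, Real.exp_le_exp]
  calc -(s * Y ω) ≤ |s| * |Y ω| := (neg_le_abs _).trans_eq (abs_mul s (Y ω))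
    _ ≤ |s| * C := by gcongr

theorem ae_pos_of_lintegral_rpow_neg (hf : Measurable f) (ht : 0 < t)
    (h : ∫⁻ ω, ENNReal.ofReal (f ω) ^ (-t) ∂P < ∞) : ∀ᵐ ω ∂P, 0 < f ω := by
  filter_upwards [ae_lt_top (by fun_prop) h.ne] with ω hω
  by_contra! hle
  rw [ENNReal.ofReal_of_nonpos hle, ENNReal.zero_rpow_of_neg (neg_neg_of_pos ht)] at hω
  exact lt_irrefl _ hω

theorem neg_mem_integrableExpSet_log (hf : Measurable f) (ht : 0 < t)
    (h : ∫⁻ ω, ENNReal.ofReal (f ω) ^ (-t) ∂P < ∞) :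
    -t ∈ integrableExpSet (fun ω => Real.log (f ω)) P := by
  rw [integrableExpSet, mem_ofPred_eq, ← lintegral_ofReal_ne_top_iff_integrable
    (hf.log.const_mul _).exp.aestronglyMeasurable
    (ae_of_all _ fun _ => (Real.exp_pos _).le)]
  refine ((lintegral_congr_ae ?_).trans_lt h).ne
  filter_upwards [ae_pos_of_lintegral_rpow_neg hf ht h] with ω hω
  rw [ENNReal.ofReal_rpow_of_pos hω, Real.rpow_def_of_pos hω, mul_comm]

theorem zero_mem_interior_integrableExpSet_log (hf : Measurable f) (hf1 : ∀ᵐ ω ∂P, f ω ≤ 1)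
    (ht : 0 < t) (h : ∫⁻ ω, ENNReal.ofReal (f ω) ^ (-t) ∂P < ∞) :
    0 ∈ interior (integrableExpSet (fun ω => Real.log (f ω)) P) := by
  have hint := neg_mem_integrableExpSet_log hf ht h
  refine mem_interior_iff_mem_nhds.2 (mem_of_superset (Ici_mem_nhds (neg_neg_of_pos ht)) ?_)
  intro s hs
  simp only [integrableExpSet, mem_ofPred_eq] at *
  refine hint.mono' (hf.log.const_mul s).exp.aestronglyMeasurable ?_
  filter_upwards [ae_pos_of_lintegral_rpow_neg hf ht h, hf1] with ω hω hω1
  rw [Real.norm_eq_abs, Real.abs_exp, Real.exp_le_exp]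
  exact mul_le_mul_of_nonpos_right hs (Real.log_nonpos hω.le hω1)

end ExponentialMoments

/-! ### The smaller increment as a function of the parameters -/

section MinIncr

variable {A B x y q θ θ' : ℝ}

theorem measurable_moranMinIncr (θ : ℝ) :
    Measurable fun u : (ℝ × ℝ) × unitInterval => moranMinIncr θ u.1.1 u.1.2 u.2 := by
  unfold moranMinIncr
  fun_prop

theorem moranMinIncr_zero_nonpos (hq : q ∈ Icc (0 : ℝ) 1) : moranMinIncr 0 x y q ≤ 0 := by
  refine (min_le_left _ _).trans ?_
  simpa only [zero_mul, sub_zero] using Real.log_nonpos hq.1 hq.2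

theorem abs_log_le_neg_log (hA : 0 < A) (hx : x ∈ Icc A 1) : |Real.log x| ≤ -Real.log A := by
  rw [abs_of_nonpos (Real.log_nonpos (hA.le.trans hx.1) hx.2), neg_le_neg_iff]
  exact Real.log_le_log hA hx.1

theorem moranMinIncr_add_le (hx : x ∈ Ioc 0 B) (hy : y ∈ Ioc 0 B) (hθ : θ ≤ θ') :
    moranMinIncr θ x y q + (θ' - θ) * -Real.log B ≤ moranMinIncr θ' x y q := by
  have hlog {z : ℝ} (hz : z ∈ Ioc 0 B) :
      (θ' - θ) * -Real.log B ≤ (θ' - θ) * -Real.log z :=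
    mul_le_mul_of_nonneg_left (neg_le_neg (Real.log_le_log hz.1 hz.2)) (sub_nonneg.2 hθ)
  rw [moranMinIncr, moranMinIncr, ← min_add_add_right]
  exact min_le_min (by linarith [hlog hx]) (by linarith [hlog hy])

theorem moranMinIncr_le_add (hA : 0 < A) (hx : x ∈ Icc A 1) (hy : y ∈ Icc A 1) :
    moranMinIncr θ' x y q ≤ moranMinIncr θ x y q + -Real.log A * |θ' - θ| := by
  have hlog {z : ℝ} (hz : z ∈ Icc A 1) :
      -((θ' - θ) * Real.log z) ≤ -Real.log A * |θ' - θ| :=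
    calc -((θ' - θ) * Real.log z) ≤ |Real.log z| * |θ' - θ| :=
          (neg_le_abs _).trans_eq ((abs_mul _ _).trans (mul_comm _ _))
      _ ≤ -Real.log A * |θ' - θ| := by
          gcongr
          exact abs_log_le_neg_log hA hz
  rw [moranMinIncr, moranMinIncr, ← min_add_add_right]
  exact min_le_min (by linarith [hlog hx]) (by linarith [hlog hy])

theorem moranY_sub_moranZ (hx : 0 < x) (hy : 0 < y) (hq : q ∈ Ioo (0 : ℝ) 1) :
    moranY θ x y q - θ * moranZ θ x y q = moranMinIncr θ x y q := by
  have hX : 0 < x ^ θ := Real.rpow_pos_of_pos hx θ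
  have hY : 0 < y ^ θ := Real.rpow_pos_of_pos hy θ
  have hq1 : 0 < 1 - q := sub_pos.2 hq.2
  have hmul : q ≤ x ^ θ / (x ^ θ + y ^ θ) ↔ q * y ^ θ ≤ (1 - q) * x ^ θ := by
    rw [le_div_iff₀ (add_pos hX hY)]
    constructor <;> intro h <;> linarith
  have hlog : q ≤ x ^ θ / (x ^ θ + y ^ θ) ↔
      Real.log q - θ * Real.log x ≤ Real.log (1 - q) - θ * Real.log y := by
    rw [hmul, ← Real.log_le_log_iff (mul_pos hq.1 hY) (mul_pos hq1 hX),
      Real.log_mul hq.1.ne' hY.ne', Real.log_mul hq1.ne' hX.ne', Real.log_rpow hx,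
      Real.log_rpow hy]
    constructor <;> intro h <;> linarith
  simp only [moranY, moranZ, moranMinIncr, hlog]
  split_ifs with h
  · rw [min_eq_left h]
  · rw [min_eq_right (le_of_not_ge h)]

theorem moranZ_mem_Icc (hA : 0 < A) (hx : x ∈ Icc A B) (hy : y ∈ Icc A B) :
    moranZ θ x y q ∈ Icc (Real.log A) (Real.log B) := by
  have hlog {z : ℝ} (hz : z ∈ Icc A B) : Real.log z ∈ Icc (Real.log A) (Real.log B) :=
    ⟨Real.log_le_log hA hz.1, Real.log_le_log (hA.trans_le hz.1) hz.2⟩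
  unfold moranZ
  split_ifs
  · exact hlog hx
  · exact hlog hy

end MinIncr

/-! ### The random model -/

/-- The smaller increment in step `n` of the random model: the summand `X n` whose partial sums
govern the local dimensions. -/
noncomputable def randomMinIncr {Ω : Type*} (a b : ℕ → Ω → ℝ) (p : ℕ → Ω → unitInterval) (θ : ℝ)
    (n : ℕ) (ω : Ω) : ℝ :=
  moranMinIncr θ (a n ω) (b n ω) (p n ω)

namespace IsMoranModel

variable {Ω : Type*} [MeasurableSpace Ω] {P : Measure Ω} {A B : ℝ}
  {a b : ℕ → Ω → ℝ} {p : ℕ → Ω → unitInterval}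

theorem isMoranRatios (h : IsMoranModel P A B a b p) (ω : Ω) :
    IsMoranRatios A B (fun n => a n ω) (fun n => b n ω) where
  A_pos := h.A_pos
  B_lt_one := h.B_lt_one
  le_a n := (h.le_min n ω).trans (min_le_left _ _)
  le_b n := (h.le_min n ω).trans (min_le_right _ _)
  add_le n := h.add_le n ω

theorem a_mem_Icc (h : IsMoranModel P A B a b p) (n : ℕ) (ω : Ω) : a n ω ∈ Icc A B :=
  ⟨(h.isMoranRatios ω).le_a n, (h.isMoranRatios ω).a_le n⟩

theorem b_mem_Icc (h : IsMoranModel P A B a b p) (n : ℕ) (ω : Ω) : b n ω ∈ Icc A B :=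
  ⟨(h.isMoranRatios ω).le_b n, (h.isMoranRatios ω).b_le n⟩

theorem log_B_neg (h : IsMoranModel P A B a b p) : Real.log B < 0 :=
  Real.log_neg (h.A_pos.trans h.A_lt_B) h.B_lt_one

theorem ae_p_mem_Ioo (h : IsMoranModel P A B a b p) :
    ∀ᵐ ω ∂P, ∀ n, (p n ω : ℝ) ∈ Ioo (0 : ℝ) 1 := by
  have hp0 := h.measurable_p 0
  obtain ⟨t, ht, hmoment⟩ := h.moment_p
  obtain ⟨t', ht', hmoment'⟩ := h.moment_one_sub_p
  have h0 : ∀ᵐ ω ∂P, p 0 ω ∈ {u : unitInterval | (u : ℝ) ∈ Ioo (0 : ℝ) 1} := by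
    filter_upwards [ae_pos_of_lintegral_rpow_neg (by fun_prop) ht hmoment,
      ae_pos_of_lintegral_rpow_neg (by fun_prop) ht' hmoment'] with ω hω hω'
    exact ⟨hω, sub_pos.1 hω'⟩
  exact ae_all_iff.2 fun n =>
    (h.identDistrib_p n).symm.ae_mem_snd (measurable_subtype_coe measurableSet_Ioo) h0

theorem measurable_randomMinIncr (h : IsMoranModel P A B a b p) (θ : ℝ) (n : ℕ) :
    Measurable (randomMinIncr a b p θ n) :=
  (measurable_moranMinIncr θ).comp
    (((h.measurable_a n).prodMk (h.measurable_b n)).prodMk (h.measurable_p n))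

theorem iIndepFun_randomMinIncr (h : IsMoranModel P A B a b p) (θ : ℝ) :
    iIndepFun (randomMinIncr a b p θ) P :=
  (iIndepFun_prodMk_of_indepFun (fun n => (h.measurable_a n).prodMk (h.measurable_b n))
    h.measurable_p h.indep_ab h.indep_p h.indep_ab_p).comp
      (fun _ u => moranMinIncr θ u.1.1 u.1.2 u.2) fun _ => measurable_moranMinIncr θ

theorem identDistrib_randomMinIncr [IsFiniteMeasure P] (h : IsMoranModel P A B a b p) (θ : ℝ)
    (n : ℕ) : IdentDistrib (randomMinIncr a b p θ n) (randomMinIncr a b p θ 0) P P := by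
  have hindep (k : ℕ) : IndepFun (fun ω => (a k ω, b k ω)) (p k) P :=
    h.indep_ab_p.comp (measurable_pi_apply k) (measurable_pi_apply k)
  exact ((h.identDistrib_ab n).prodMk (h.identDistrib_p n) (hindep n) (hindep 0)).comp
    (measurable_moranMinIncr θ)

theorem zero_mem_interior_integrableExpSet_log_p (h : IsMoranModel P A B a b p) :
    0 ∈ interior (integrableExpSet (fun ω => Real.log (p 0 ω : ℝ)) P) := by
  have hp := h.measurable_p 0
  obtain ⟨t, ht, hmoment⟩ := h.moment_p
  exact zero_mem_interior_integrableExpSet_log (by fun_prop) (ae_of_all _ fun ω => (p 0 ω).2.2) ht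
    hmoment

theorem zero_mem_interior_integrableExpSet_log_one_sub_p (h : IsMoranModel P A B a b p) :
    0 ∈ interior (integrableExpSet (fun ω => Real.log (1 - (p 0 ω : ℝ))) P) := by
  have hp := h.measurable_p 0
  obtain ⟨t, ht, hmoment⟩ := h.moment_one_sub_p
  exact zero_mem_interior_integrableExpSet_log (by fun_prop)
    (ae_of_all _ fun ω => sub_le_self 1 (p 0 ω).2.1) ht hmoment

theorem zero_mem_interior_integrableExpSet_randomMinIncr (h : IsMoranModel P A B a b p) (θ : ℝ) :
    0 ∈ interior (integrableExpSet (randomMinIncr a b p θ 0) P) := by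
  have hbound {x : ℝ} (hx : x ∈ Icc A B) : |θ * Real.log x| ≤ |θ| * -Real.log A := by
    rw [abs_mul]
    gcongr
    exact abs_log_le_neg_log h.A_pos ⟨hx.1, hx.2.trans h.B_lt_one.le⟩
  rw [mem_interior_iff_mem_nhds]
  filter_upwards [mem_interior_iff_mem_nhds.1 h.zero_mem_interior_integrableExpSet_log_p,
    mem_interior_iff_mem_nhds.1 h.zero_mem_interior_integrableExpSet_log_one_sub_p] with s hs hs'
  exact mem_integrableExpSet_min
    (mem_integrableExpSet_sub_of_bounded hs ((h.measurable_a 0).log.const_mul θ).aemeasurable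
      (ae_of_all _ fun ω => hbound (h.a_mem_Icc 0 ω)))
    (mem_integrableExpSet_sub_of_bounded hs' ((h.measurable_b 0).log.const_mul θ).aemeasurable
      (ae_of_all _ fun ω => hbound (h.b_mem_Icc 0 ω)))

theorem integrable_randomMinIncr (h : IsMoranModel P A B a b p) (θ : ℝ) :
    Integrable (randomMinIncr a b p θ 0) P :=
  integrable_of_mem_interior_integrableExpSet
    (h.zero_mem_interior_integrableExpSet_randomMinIncr θ)

theorem measurableSet_p_le (h : IsMoranModel P A B a b p) (θ : ℝ) :
    MeasurableSet {ω | (p 0 ω : ℝ) ≤ a 0 ω ^ θ / (a 0 ω ^ θ + b 0 ω ^ θ)} := by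
  have ha := h.measurable_a 0
  have hb := h.measurable_b 0
  have hp := h.measurable_p 0
  exact measurableSet_le (by fun_prop) (by fun_prop)

theorem integrable_moranY (h : IsMoranModel P A B a b p) (θ : ℝ) :
    Integrable (fun ω => moranY θ (a 0 ω) (b 0 ω) (p 0 ω)) P := by
  have hlog_p := integrable_of_mem_interior_integrableExpSet
    h.zero_mem_interior_integrableExpSet_log_p
  have hlog_one_sub_p := integrable_of_mem_interior_integrableExpSet
    h.zero_mem_interior_integrableExpSet_log_one_sub_p
  exact Integrable.piecewise (s := {ω | (p 0 ω : ℝ) ≤ a 0 ω ^ θ / (a 0 ω ^ θ + b 0 ω ^ θ)})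
    (h.measurableSet_p_le θ) hlog_p.integrableOn hlog_one_sub_p.integrableOn

/-! ### The mean increment as a function of `θ` -/

variable [IsProbabilityMeasure P]

theorem integral_randomMinIncr_add_le (h : IsMoranModel P A B a b p) {θ θ' : ℝ} (hθ : θ ≤ θ') :
    ∫ ω, randomMinIncr a b p θ 0 ω ∂P + (θ' - θ) * -Real.log B ≤
      ∫ ω, randomMinIncr a b p θ' 0 ω ∂P := by
  have hint := h.integrable_randomMinIncr θ
  calc ∫ ω, randomMinIncr a b p θ 0 ω ∂P + (θ' - θ) * -Real.log B
      = ∫ ω, (randomMinIncr a b p θ 0 ω + (θ' - θ) * -Real.log B) ∂P := by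
        rw [integral_add hint (integrable_const _), integral_const, probReal_univ, one_smul]
    _ ≤ ∫ ω, randomMinIncr a b p θ' 0 ω ∂P :=
        integral_mono (hint.add (integrable_const _)) (h.integrable_randomMinIncr θ') fun ω =>
          moranMinIncr_add_le ⟨(h.isMoranRatios ω).a_pos 0, (h.a_mem_Icc 0 ω).2⟩
            ⟨(h.isMoranRatios ω).b_pos 0, (h.b_mem_Icc 0 ω).2⟩ hθ

theorem integral_randomMinIncr_le_add (h : IsMoranModel P A B a b p) (θ θ' : ℝ) :
    ∫ ω, randomMinIncr a b p θ' 0 ω ∂P ≤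
      ∫ ω, randomMinIncr a b p θ 0 ω ∂P + -Real.log A * |θ' - θ| := by
  have hint := h.integrable_randomMinIncr θ
  have hle_one {x : ℝ} (hx : x ∈ Icc A B) : x ∈ Icc A 1 := ⟨hx.1, hx.2.trans h.B_lt_one.le⟩
  calc ∫ ω, randomMinIncr a b p θ' 0 ω ∂P
      ≤ ∫ ω, (randomMinIncr a b p θ 0 ω + -Real.log A * |θ' - θ|) ∂P :=
        integral_mono (h.integrable_randomMinIncr θ') (hint.add (integrable_const _)) fun ω =>
          moranMinIncr_le_add h.A_pos (hle_one (h.a_mem_Icc 0 ω)) (hle_one (h.b_mem_Icc 0 ω))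
    _ = ∫ ω, randomMinIncr a b p θ 0 ω ∂P + -Real.log A * |θ' - θ| := by
        rw [integral_add hint (integrable_const _), integral_const, probReal_univ, one_smul]

theorem strictMono_integral_randomMinIncr (h : IsMoranModel P A B a b p) :
    StrictMono fun θ => ∫ ω, randomMinIncr a b p θ 0 ω ∂P := fun _ _ hθ =>
  (lt_add_of_pos_right _ (mul_pos (sub_pos.2 hθ) (neg_pos.2 h.log_B_neg))).trans_le
    (h.integral_randomMinIncr_add_le hθ.le)

theorem continuous_integral_randomMinIncr (h : IsMoranModel P A B a b p) :
    Continuous fun θ => ∫ ω, randomMinIncr a b p θ 0 ω ∂P :=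
  (LipschitzWith.of_le_add_mul' (-Real.log A) fun θ' θ =>
    h.integral_randomMinIncr_le_add θ θ').continuous

theorem exists_integral_randomMinIncr_eq_zero (h : IsMoranModel P A B a b p) :
    ∃ α ≥ 0, ∫ ω, randomMinIncr a b p α 0 ω ∂P = 0 := by
  let m : ℝ → ℝ := fun θ => ∫ ω, randomMinIncr a b p θ 0 ω ∂P
  have hlogB : 0 < -Real.log B := neg_pos.2 h.log_B_neg
  have hm_zero : m 0 ≤ 0 := integral_nonpos fun ω => moranMinIncr_zero_nonpos (p 0 ω).2
  have hθ : 0 ≤ -m 0 / -Real.log B := div_nonneg (neg_nonneg.2 hm_zero) hlogB.le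
  have hm : 0 ≤ m (-m 0 / -Real.log B) := by
    have hgrowth := h.integral_randomMinIncr_add_le hθ
    rwa [sub_zero, div_mul_cancel₀ _ hlogB.ne', add_neg_cancel] at hgrowth
  obtain ⟨α, hα, hα0⟩ := intermediate_value_Icc hθ h.continuous_integral_randomMinIncr.continuousOn
    ⟨hm_zero, hm⟩
  exact ⟨α, hα.1, hα0⟩

/-! ### Comparison with `G` -/

theorem integrable_moranZ (h : IsMoranModel P A B a b p) (θ : ℝ) :
    Integrable (fun ω => moranZ θ (a 0 ω) (b 0 ω) (p 0 ω)) P :=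
  Integrable.of_mem_Icc (Real.log A) (Real.log B)
    (Measurable.ite (h.measurableSet_p_le θ) (h.measurable_a 0).log
      (h.measurable_b 0).log).aemeasurable
    (ae_of_all _ fun ω => moranZ_mem_Icc h.A_pos (h.a_mem_Icc 0 ω) (h.b_mem_Icc 0 ω))

theorem integral_moranZ_neg (h : IsMoranModel P A B a b p) (θ : ℝ) :
    ∫ ω, moranZ θ (a 0 ω) (b 0 ω) (p 0 ω) ∂P < 0 :=
  calc ∫ ω, moranZ θ (a 0 ω) (b 0 ω) (p 0 ω) ∂P ≤ ∫ _, Real.log B ∂P :=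
        integral_mono (h.integrable_moranZ θ) (integrable_const _) fun ω =>
          (moranZ_mem_Icc h.A_pos (h.a_mem_Icc 0 ω) (h.b_mem_Icc 0 ω)).2
    _ = Real.log B := by rw [integral_const, probReal_univ, one_smul]
    _ < 0 := h.log_B_neg

theorem integral_randomMinIncr_eq (h : IsMoranModel P A B a b p) (θ : ℝ) :
    ∫ ω, randomMinIncr a b p θ 0 ω ∂P =
      ∫ ω, moranY θ (a 0 ω) (b 0 ω) (p 0 ω) ∂P -
        θ * ∫ ω, moranZ θ (a 0 ω) (b 0 ω) (p 0 ω) ∂P := by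
  rw [← integral_const_mul,
    ← integral_sub (h.integrable_moranY θ) ((h.integrable_moranZ θ).const_mul θ)]
  refine integral_congr_ae ?_
  filter_upwards [h.ae_p_mem_Ioo] with ω hω
  exact (moranY_sub_moranZ ((h.isMoranRatios ω).a_pos 0) ((h.isMoranRatios ω).b_pos 0) (hω 0)).symm

theorem moranG_sub_eq_div (h : IsMoranModel P A B a b p) (θ : ℝ) :
    moranG P a b p θ - θ =
      (∫ ω, randomMinIncr a b p θ 0 ω ∂P) / ∫ ω, moranZ θ (a 0 ω) (b 0 ω) (p 0 ω) ∂P := by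
  rw [h.integral_randomMinIncr_eq, moranG, sub_div,
    mul_div_cancel_right₀ _ (h.integral_moranZ_neg θ).ne]

theorem moranG_eq_iff (h : IsMoranModel P A B a b p) (θ : ℝ) :
    moranG P a b p θ = θ ↔ ∫ ω, randomMinIncr a b p θ 0 ω ∂P = 0 := by
  rw [← sub_eq_zero, h.moranG_sub_eq_div, div_eq_zero_iff, or_iff_left (h.integral_moranZ_neg θ).ne]

theorem moranG_lt_iff (h : IsMoranModel P A B a b p) (θ : ℝ) :
    moranG P a b p θ < θ ↔ 0 < ∫ ω, randomMinIncr a b p θ 0 ω ∂P := by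
  rw [← sub_neg, h.moranG_sub_eq_div, div_lt_iff_of_neg (h.integral_moranZ_neg θ), zero_mul]

theorem existsUnique_moranG_eq (h : IsMoranModel P A B a b p) :
    ∃! α : ℝ, 0 ≤ α ∧ moranG P a b p α = α ∧ ∀ ψ, α < ψ → moranG P a b p ψ < ψ := by
  obtain ⟨α, hα, hα0⟩ := h.exists_integral_randomMinIncr_eq_zero
  refine ⟨α, ⟨hα, (h.moranG_eq_iff α).2 hα0, fun ψ hψ => (h.moranG_lt_iff ψ).2 ?_⟩, ?_⟩
  · exact hα0.symm.trans_lt (h.strictMono_integral_randomMinIncr hψ)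
  · rintro β ⟨-, hβ, -⟩
    exact h.strictMono_integral_randomMinIncr.injective
      (((h.moranG_eq_iff β).1 hβ).trans hα0.symm)

/-! ### The dimension of the random Moran measure -/

theorem ae_le_upperPhiDim (h : IsMoranModel P A B a b p) {α : ℝ}
    (hα : ∫ ω, randomMinIncr a b p α 0 ω ∂P ≤ 0) :
    ∀ᵐ ω ∂P, ∀ Φ : ℝ → ℝ, (∀ᶠ t in 𝓝[>] 0, 0 ≤ Φ t) →
      (α : EReal) ≤
        upperPhiDim Φ (moranMeasure (fun n => a n ω) (fun n => b n ω) (fun n => p n ω)) := by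
  have hsum (q : ℚ) (hq : (q : ℝ) < α) :
      ∀ᵐ ω ∂P, ∀ᶠ n in atTop, ∑ i ∈ Finset.range n, randomMinIncr a b p q i ω < 0 :=
    ae_eventually_sum_range_neg (h.integrable_randomMinIncr q)
      (fun _ _ hij => (h.iIndepFun_randomMinIncr q).indepFun hij) (h.identDistrib_randomMinIncr q)
      ((h.strictMono_integral_randomMinIncr hq).trans_le hα)
  filter_upwards [h.ae_p_mem_Ioo, ae_all_iff.2 fun q => eventually_imp_distrib_left.2 (hsum q)]
    with ω hp hω Φ hΦ
  by_contra! hlt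
  obtain ⟨q, hdim_lt, hq⟩ := EReal.lt_iff_exists_rat_btwn.1 hlt
  exact hdim_lt.not_ge ((h.isMoranRatios ω).le_upperPhiDim hp hΦ
    ((hω q (EReal.coe_lt_coe_iff.1 hq)).frequently.mono fun _ => le_of_lt))

theorem ae_upperPhiDim_le (h : IsMoranModel P A B a b p) {α : ℝ} (hα : 0 ≤ α)
    (hmean : 0 ≤ ∫ ω, randomMinIncr a b p α 0 ω ∂P) :
    ∀ᵐ ω ∂P, ∀ Φ : ℝ → ℝ, IsLargeDimensionFunction Φ →
      upperPhiDim Φ (moranMeasure (fun n => a n ω) (fun n => b n ω) (fun n => p n ω)) ≤ α := by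
  have hsum (q : ℚ) (hq : α < q) : ∃ K ≥ 0, ∀ᵐ ω ∂P, ∀ᶠ n : ℕ in atTop, ∀ k : ℕ,
      K * Real.log n ≤ k → 0 < ∑ i ∈ Finset.Ico n (n + k), randomMinIncr a b p q i ω :=
    exists_ae_eventually_sum_Ico_pos (h.measurable_randomMinIncr q) (h.iIndepFun_randomMinIncr q)
      (h.identDistrib_randomMinIncr q) (h.zero_mem_interior_integrableExpSet_randomMinIncr q)
      (hmean.trans_lt (h.strictMono_integral_randomMinIncr hq))
  choose! K hK hsum using hsum
  filter_upwards [h.ae_p_mem_Ioo, ae_all_iff.2 fun q => eventually_imp_distrib_left.2 (hsum q)]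
    with ω hp hω Φ hΦ
  by_contra! hlt
  obtain ⟨q, hq, hlt_dim⟩ := EReal.lt_iff_exists_rat_btwn.1 hlt
  have hαq : α < q := EReal.coe_lt_coe_iff.1 hq
  exact hlt_dim.not_ge ((h.isMoranRatios ω).upperPhiDim_le hp hΦ (hα.trans hαq.le) (hK q hαq)
    ((hω q hαq).mono fun n hn k hk => (hn k hk).le))

end IsMoranModel

theorem mainTheorem4_general {Ω : Type*} [MeasurableSpace Ω] (P : Measure Ω)
    [IsProbabilityMeasure P] (A B : ℝ) (a b : ℕ → Ω → ℝ) (p : ℕ → Ω → unitInterval)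
    (hmodel : IsMoranModel P A B a b p) :
    (∃! α : ℝ, 0 ≤ α ∧ moranG P a b p α = α ∧ ∀ ψ, α < ψ → moranG P a b p ψ < ψ) ∧
      ∀ α : ℝ, (0 ≤ α ∧ moranG P a b p α = α ∧ ∀ ψ, α < ψ → moranG P a b p ψ < ψ) →
        ∀ᵐ ω ∂P, ∀ Φ : ℝ → ℝ, IsLargeDimensionFunction Φ →
          upperPhiDim Φ (moranMeasure (fun n => a n ω) (fun n => b n ω) (fun n => p n ω)) =
            (α : EReal) := by
  refine ⟨hmodel.existsUnique_moranG_eq, ?_⟩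
  rintro α ⟨hα, hGα, -⟩
  have hmean := (hmodel.moranG_eq_iff α).1 hGα
  filter_upwards [hmodel.ae_upperPhiDim_le hα hmean.ge, hmodel.ae_le_upperPhiDim hmean.le]
    with ω hle hge Φ hΦ
  exact le_antisymm (hle Φ hΦ) (hge Φ hΦ.eventually_nonneg)

theorem mainTheorem4 {Ω : Type*} [MeasurableSpace Ω] (P : Measure Ω) [IsProbabilityMeasure P]
    (A B : ℝ) (a b : ℕ → Ω → ℝ) (p : ℕ → Ω → unitInterval) (hmodel : IsMoranModel P A B a b p)
    (hlog_p : Integrable (fun ω => Real.log (p 0 ω : ℝ)) P)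
    (hlog_one_sub_p : Integrable (fun ω => Real.log (1 - (p 0 ω : ℝ))) P)
    (hG : ContinuousOn (moranG P a b p) (Ici 0)) :
    (∃! α : ℝ, 0 ≤ α ∧ moranG P a b p α = α ∧ ∀ ψ, α < ψ → moranG P a b p ψ < ψ) ∧
      ∀ α : ℝ, (0 ≤ α ∧ moranG P a b p α = α ∧ ∀ ψ, α < ψ → moranG P a b p ψ < ψ) →
        ∀ᵐ ω ∂P, ∀ Φ : ℝ → ℝ, IsLargeDimensionFunction Φ →
          upperPhiDim Φ (moranMeasure (fun n => a n ω) (fun n => b n ω) (fun n => p n ω)) =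
            (α : EReal) :=
  mainTheorem4_general P A B a b p hmodel
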